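/- Let $R$ be an associative ring with identity $1 \neq 0$ which is right noetherian (in particular, $R$ may be any two-sided noetherian ring). Let $R_R$ denote $R$ regarded as a right module over itself, so that its submodules are the right ideals of $R$; homomorphisms below are homomorphisms of right $R$-modules and monomorphisms are injective ones. A nonzero module $M$ is called *compressible* if for every nonzero submodule $N$ of $M$ there is a monomorphism $M \to N$. It is called *critically compressible* if it is compressible and there is no monomorphism $M \to M/N$ for any nonzero submodule $N$ of $M$. A nonzero module is called *uniform* if any two of its nonzero submodules have nonzero intersection. Then the following conditions are equivalent: (i) $R_R$ is compressible; (ii) $R_R$ is critically compressible; (iii) for every uniform submodule $U$ of $R_R$ there is a monomorphism $R_R \to U$; (iv) for every cyclic uniform submodule $U = uR$ ($u \in R$) of $R_R$ there is a monomorphism $R_R \to U$. -/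

import Mathlib

namespace CompressibleModules

section

variable (R : Type*) [Ring R]

/-- There is an `R`-module monomorphism `M → N`. -/
def Embeds (M N : Type*) [AddCommGroup M] [Module R M] [AddCommGroup N] [Module R N] : Prop :=
  ∃ f : M →ₗ[R] N, Function.Injective f

/-- A nonzero module `M` is compressible if it embeds in each of its nonzero submodules. -/
def IsCompressible (M : Type*) [AddCommGroup M] [Module R M] : Prop :=
  Nontrivial M ∧ ∀ N : Submodule R M, N ≠ ⊥ → Embeds R M N

/-- A module `M` is critically compressible if it is compressible and does not embed in any of its
proper factor modules, that is, in any `M ⧸ N` with `N ≠ 0`. -/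
def IsCriticallyCompressible (M : Type*) [AddCommGroup M] [Module R M] : Prop :=
  IsCompressible R M ∧ ∀ N : Submodule R M, N ≠ ⊥ → ¬ Embeds R M (M ⧸ N)

/-- A nonzero module is uniform if any two nonzero submodules have nonzero intersection. -/
def IsUniform (M : Type*) [AddCommGroup M] [Module R M] : Prop :=
  Nontrivial M ∧ ∀ N₁ N₂ : Submodule R M, N₁ ≠ ⊥ → N₂ ≠ ⊥ → N₁ ⊓ N₂ ≠ ⊥

end

end CompressibleModules

namespace CompressibleModules

section

variable {R : Type*} [Ring R] {M N : Type*} [AddCommGroup M] [Module R M]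
  [AddCommGroup N] [Module R N]

/-! Noetherianity puts a cyclic uniform right ideal inside every nonzero one, so (iv) gives (i). It
also makes a compressible `R_R` uniform, since `R_R` embeds in a uniform submodule. A monomorphism
`R → R ⧸ V` has the form `r ↦ a * r + V`, and injectivity forces `aR ∩ V = 0`; uniformity forbids
this when `V ≠ 0`. -/

theorem Embeds.trans_le {U V : Submodule R N} (h : Embeds R M U) (hUV : U ≤ V) :
    Embeds R M V := by
  obtain ⟨f, hf⟩ := h
  exact ⟨Submodule.inclusion hUV ∘ₗ f, (Submodule.inclusion_injective hUV).comp hf⟩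

theorem map_ne_bot {f : M →ₗ[R] N} (hf : Function.Injective f) {A : Submodule R M}
    (hA : A ≠ ⊥) : A.map f ≠ ⊥ := fun h =>
  hA (Submodule.map_injective_of_injective hf (h.trans (Submodule.map_bot f).symm))

/-- A nonzero module that embeds in a uniform module is uniform. -/
theorem IsUniform.of_embeds [Nontrivial M] (hN : IsUniform R N) (h : Embeds R M N) :
    IsUniform R M := by
  obtain ⟨f, hf⟩ := h
  refine ⟨inferInstance, fun A B hA hB hAB => ?_⟩
  refine hN.2 (A.map f) (B.map f) (map_ne_bot hf hA) (map_ne_bot hf hB) ?_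
  rw [← Submodule.map_inf f hf, hAB, Submodule.map_bot]

/-- Every nonzero submodule of a noetherian module contains a uniform submodule. -/
theorem exists_isUniform_le [IsNoetherian R M] {V : Submodule R M} (hV : V ≠ ⊥) :
    ∃ U ≤ V, IsUniform R U := by
  -- Minimal for `>` means `K` is maximal among submodules disjoint from some nonzero `L ≤ V`.
  -- Nonzero `A`, `B` in `L` with `A ⊓ B = ⊥` would let `K ⊔ A`, disjoint from `B`, replace `K`.
  obtain ⟨K, ⟨L, hLV, hL, hKL⟩, hmax⟩ := WellFounded.has_min
    (wellFounded_gt (α := Submodule R M))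
    {K | ∃ L ≤ V, L ≠ ⊥ ∧ Disjoint K L} ⟨⊥, V, le_rfl, hV, disjoint_bot_left⟩
  refine ⟨L, hLV, Submodule.nontrivial_iff_ne_bot.mpr hL, fun A B hA hB hAB => ?_⟩
  have hinj := L.injective_subtype
  have hA' : A.map L.subtype ≠ ⊥ := map_ne_bot hinj hA
  have hB' : B.map L.subtype ≠ ⊥ := map_ne_bot hinj hB
  have hdisj : Disjoint (A.map L.subtype) (B.map L.subtype) := by
    rw [disjoint_iff, ← Submodule.map_inf _ hinj, hAB, Submodule.map_bot]
  have hAL := Submodule.map_subtype_le L A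
  have hBL := Submodule.map_subtype_le L B
  refine hmax (K ⊔ A.map L.subtype) ⟨B.map L.subtype, hBL.trans hLV, hB',
    hdisj.disjoint_sup_left_of_disjoint_sup_right (hKL.mono_right (sup_le hAL hBL))⟩ ?_
  refine lt_of_le_of_ne le_sup_left fun h => hA' ?_
  exact (hKL.mono_right hAL).symm.eq_bot_of_le (h ▸ le_sup_right)

/-- Every nonzero submodule of a noetherian module contains a cyclic uniform submodule. -/
theorem exists_span_singleton_isUniform_le [IsNoetherian R M] {V : Submodule R M}
    (hV : V ≠ ⊥) : ∃ u : M, Submodule.span R {u} ≤ V ∧ IsUniform R (Submodule.span R {u}) := by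
  obtain ⟨U, hUV, hU⟩ := exists_isUniform_le hV
  obtain ⟨u, huU, hu⟩ := U.exists_mem_ne_zero_of_ne_bot (Submodule.nontrivial_iff_ne_bot.mp hU.1)
  have hle : Submodule.span R {u} ≤ U := (Submodule.span_singleton_le_iff_mem u U).mpr huU
  have : Nontrivial (Submodule.span R {u}) := by
    rwa [Submodule.nontrivial_iff_ne_bot, Ne, Submodule.span_singleton_eq_bot]
  exact ⟨u, hle.trans hUV, hU.of_embeds ⟨_, Submodule.inclusion_injective hle⟩⟩

/-- A compressible noetherian module is uniform. -/
theorem IsCompressible.isUniform [IsNoetherian R M] (h : IsCompressible R M) :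
    IsUniform R M := by
  have := h.1
  obtain ⟨U, -, hU⟩ := exists_isUniform_le (R := R) (M := M) top_ne_bot
  exact hU.of_embeds (h.2 U (Submodule.nontrivial_iff_ne_bot.mp hU.1))

end

/-- If `R` is uniform as a right module, then it does not embed in a proper factor module. -/
theorem IsUniform.not_embeds_quotient {R : Type*} [Ring R] (h : IsUniform Rᵐᵒᵖ R)
    {V : Submodule Rᵐᵒᵖ R} (hV : V ≠ ⊥) : ¬ Embeds Rᵐᵒᵖ R (R ⧸ V) := by
  rintro ⟨f, hf⟩
  have := h.1
  obtain ⟨a, ha⟩ := V.mkQ_surjective (f 1)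
  have key (r : R) (hr : a * r ∈ V) : r = 0 := by
    apply hf
    have : f r = V.mkQ (a * r) := by
      rw [← op_smul_eq_mul, map_smul, ha, ← map_smul, op_smul_eq_mul, one_mul]
    rw [this, map_zero, Submodule.mkQ_apply, Submodule.Quotient.mk_eq_zero]
    exact hr
  have ha0 : a ≠ 0 := by
    rintro rfl
    exact one_ne_zero (key 1 (by simp))
  -- A nonzero `x = a * r` in `aR ∩ V` contradicts `key`, which gives `r = 0`.
  obtain ⟨x, hx, hx0⟩ := Submodule.exists_mem_ne_zero_of_ne_bot
    (h.2 (Submodule.span Rᵐᵒᵖ {a}) V (by simpa using ha0) hV)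
  obtain ⟨r, rfl⟩ := Submodule.mem_span_singleton.mp hx.1
  have hr : a * r.unop = 0 := by rw [key r.unop hx.2, mul_zero]
  exact hx0 hr

end CompressibleModules

/- The right module `R_R` is `R` as a module over `Rᵐᵒᵖ`; its submodules are the right ideals. -/
theorem proposition2p13 (R : Type*) [Ring R] [Nontrivial R] [IsNoetherian Rᵐᵒᵖ R] :
    List.TFAE [
      CompressibleModules.IsCompressible Rᵐᵒᵖ R,
      CompressibleModules.IsCriticallyCompressible Rᵐᵒᵖ R,
      ∀ U : Submodule Rᵐᵒᵖ R,
        CompressibleModules.IsUniform Rᵐᵒᵖ U → CompressibleModules.Embeds Rᵐᵒᵖ R U,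
      ∀ U : Submodule Rᵐᵒᵖ R, (∃ u : R, U = Submodule.span Rᵐᵒᵖ {u}) →
        CompressibleModules.IsUniform Rᵐᵒᵖ U → CompressibleModules.Embeds Rᵐᵒᵖ R U] := by
  tfae_have 1 → 2 := fun h => ⟨h, fun _ hV => h.isUniform.not_embeds_quotient hV⟩
  tfae_have 2 → 3 := fun h U hU => h.1.2 U (Submodule.nontrivial_iff_ne_bot.mp hU.1)
  tfae_have 3 → 4 := fun h U _ hU => h U hU
  tfae_have 4 → 1 := fun h => ⟨inferInstance, fun V hV => by
    obtain ⟨u, huV, hu⟩ := CompressibleModules.exists_span_singleton_isUniform_le hV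
    exact (h _ ⟨u, rfl⟩ hu).trans_le huV⟩
  tfae_finish
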